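/- Let $\mathcal{Z}$ be a compact metric space with its Borel $\sigma$-field, and let $P$ be a transition (Markov) kernel on $\mathcal{Z}$ with $n$-step kernels $P^n$. Assume: - $P$ is weak Feller: for every bounded continuous $f:\mathcal{Z}\to\mathbb{R}$, the function $z\mapsto\int f(y)\,P(z,dy)$ is continuous; - $P$ is an L-chain: for every Lipschitz continuous $f:\mathcal{Z}\to\mathbb{R}$ with compact support, the sequence of functions $z\mapsto\int f(y)\,P^n(z,dy)$, $n\ge 0$, is equicontinuous; - $z^*\in\mathcal{Z}$ is topologically reachable: for every $y\in\mathcal{Z}$ and every open neighborhood $O$ of $z^*$ there is $k>0$ with $P^k(y,O)>0$. Then: (i) there exists a unique invariant probability measure $\nu$, i.e. a unique probability measure $\nu$ with $\int P(z,\cdot)\,\nu(dz)=\nu$; (ii) if moreover $z^*$ is topologically aperiodic, i.e. for every open neighborhood $O$ of $z^*$ one has $P^k(z^*,O)>0$ for all sufficiently large $k$, then for every initial probability measure $\mu$ on $\mathcal{Z}$ the laws $\mu P^n=\int P^n(z,\cdot)\,\mu(dz)$ converge weakly to $\nu$ as $n\to\infty$. -/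

import Mathlib

open MeasureTheory ProbabilityTheory Filter Topology
open scoped BoundedContinuousFunction

namespace MarkovChain

variable {Z : Type*} [MeasurableSpace Z]

theorem isMarkovKernel_pow (P : Kernel Z Z) [IsMarkovKernel P] (n : ℕ) :
    IsMarkovKernel (P ^ n) := by
  induction n with
  | zero =>
    rw [pow_zero]
    exact inferInstanceAs (IsMarkovKernel Kernel.id)
  | succ n ih =>
    have h : P ^ (n + 1) = (P ^ n) ∘ₖ P := pow_succ P n
    rw [h]
    infer_instance

/-- The law of the `n`-th state of the chain with transition kernel `P` and initial law `μ`: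
the probability measure `A ↦ ∫ P^n(z, A) μ(dz)`. -/
noncomputable def nStepLaw (P : Kernel Z Z) [IsMarkovKernel P] (μ : ProbabilityMeasure Z)
    (n : ℕ) : ProbabilityMeasure Z :=
  ⟨(μ : Measure Z).bind (P ^ n : Kernel Z Z), by
    have := isMarkovKernel_pow P n
    infer_instance⟩

/-- `P` has the weak Feller property: it maps bounded continuous functions to
continuous functions. -/
def WeakFeller [TopologicalSpace Z] (P : Kernel Z Z) : Prop :=
  ∀ f : Z →ᵇ ℝ, Continuous fun z => ∫ y, f y ∂(P z)

/-- `P` is an L-chain: for each compactly supported Lipschitz function `f`, the sequence of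
functions `z ↦ ∫ f(y) P^n(z, dy)` is equicontinuous. -/
def IsLChain [PseudoMetricSpace Z] (P : Kernel Z Z) : Prop :=
  ∀ f : Z → ℝ, (∃ K, LipschitzWith K f) → HasCompactSupport f →
    Equicontinuous fun (n : ℕ) (z : Z) => ∫ y, f y ∂((P ^ n) z)

/-- `x` is topologically reachable: from every state, each open neighbourhood of `x` is
charged by the `k`-step law for some `k > 0`. -/
def TopologicallyReachable [TopologicalSpace Z] (P : Kernel Z Z) (x : Z) : Prop :=
  ∀ y : Z, ∀ O : Set Z, IsOpen O → x ∈ O → ∃ k : ℕ, 0 < k ∧ 0 < (P ^ k) y O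

/-- `x` is topologically aperiodic: each open neighbourhood `O` of `x` satisfies
`P^k(x, O) > 0` for all sufficiently large `k`. -/
def TopologicallyAperiodic [TopologicalSpace Z] (P : Kernel Z Z) (x : Z) : Prop :=
  ∀ O : Set Z, IsOpen O → x ∈ O → ∀ᶠ k : ℕ in atTop, 0 < (P ^ k) x O

end MarkovChain

/-! Let `T` be the Markov operator on continuous functions. By the L-chain property and
Arzelà–Ascoli, the orbit `T ^ n f` of a Lipschitz `f` is relatively compact in the uniform norm, and
Lipschitz test functions suffice to identify measures and weak limits.

Existence is Krylov–Bogolyubov. For uniqueness, a uniform limit point of the Cesàro means of `f` is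
harmonic, hence constant by the maximum principle at the reachable point; every invariant law must
then integrate `f` to that constant.

For convergence, take `0 ≤ f ≤ c`. The maxima of `T ^ n f` decrease to some `M`, and those of `c - T
^ n f` to some `M'`. Limits of the shifted orbit form bi-infinite trajectories of `T` whose members
all have maximum exactly `M` and minimum exactly `c - M'`. Going backwards in time, reachability
brings the maximum to `zstar` at one time, and aperiodicity then does so at all times. Applying
reachability to the reflected trajectory brings the minimum to `zstar` too, so `M = c - M'`: the
oscillation of `T ^ n f` vanishes in the limit. -/

namespace MarkovChain

/-! ### The Markov operator and the maximum principle. -/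

section Operator

variable {Z : Type*} [MetricSpace Z] [CompactSpace Z] [MeasurableSpace Z] [BorelSpace Z]

/-- The Markov operator `f ↦ (z ↦ ∫ f(y) P(z, dy))` of a weak Feller kernel, acting on bounded
continuous functions. -/
noncomputable def markovOp (P : Kernel Z Z) [IsMarkovKernel P] (hF : WeakFeller P) :
    (Z →ᵇ ℝ) →L[ℝ] (Z →ᵇ ℝ) :=
  LinearMap.mkContinuous
    { toFun := fun f => BoundedContinuousFunction.mkOfCompact ⟨fun z => ∫ y, f y ∂(P z), hF f⟩
      map_add' := fun f g => by
        ext z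
        exact integral_add (f.integrable _) (g.integrable _)
      map_smul' := fun c f => by
        ext z
        exact integral_const_mul c _ }
    1 (fun f => by
      rw [one_mul, BoundedContinuousFunction.norm_le (norm_nonneg f)]
      intro z
      exact f.norm_integral_le_norm (P z))

variable {P : Kernel Z Z} [IsMarkovKernel P] (hF : WeakFeller P)

theorem norm_markovOp_le (f : Z →ᵇ ℝ) : ‖markovOp P hF f‖ ≤ ‖f‖ := by
  rw [BoundedContinuousFunction.norm_le (norm_nonneg f)]
  exact fun z => f.norm_integral_le_norm (P z)

theorem markovOp_pow_apply (n : ℕ) (f : Z →ᵇ ℝ) (z : Z) :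
    (markovOp P hF ^ n) f z = ∫ y, f y ∂((P ^ n) z) := by
  induction n generalizing z with
  | zero =>
    have h : ((P ^ 0) z : Measure Z) = Measure.dirac z := by
      rw [pow_zero]; exact Kernel.id_apply z
    rw [h, integral_dirac]; simp
  | succ n ih =>
    have := isMarkovKernel_pow P n
    have h : P ^ (n + 1) = (P ^ n) ∘ₖ P := pow_succ P n
    rw [h, Kernel.integral_comp (f.integrable _), pow_succ']
    change ∫ y, (markovOp P hF ^ n) f y ∂(P z) = _
    simp_rw [ih]

theorem markovOp_pow_const (n : ℕ) (c : ℝ) :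
    (markovOp P hF ^ n) (BoundedContinuousFunction.const Z c) =
      BoundedContinuousFunction.const Z c := by
  have := isMarkovKernel_pow P n
  ext z
  rw [markovOp_pow_apply]
  simp

theorem norm_markovOp_pow_le (n : ℕ) (f : Z →ᵇ ℝ) : ‖(markovOp P hF ^ n) f‖ ≤ ‖f‖ := by
  have := isMarkovKernel_pow P n
  rw [BoundedContinuousFunction.norm_le (norm_nonneg f)]
  intro z
  rw [markovOp_pow_apply]
  exact f.norm_integral_le_norm _

theorem markovOp_pow_nonneg (n : ℕ) {f : Z →ᵇ ℝ} (hf : ∀ z, 0 ≤ f z) (z : Z) :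
    0 ≤ (markovOp P hF ^ n) f z := by
  rw [markovOp_pow_apply]
  exact integral_nonneg hf

theorem integral_bind_pow (μ : Measure Z) [IsFiniteMeasure μ] (n : ℕ) (f : Z →ᵇ ℝ) :
    ∫ y, f y ∂(μ.bind (P ^ n : Kernel Z Z)) = ∫ z, (markovOp P hF ^ n) f z ∂μ := by
  have := isMarkovKernel_pow P n
  simp_rw [markovOp_pow_apply]
  have h := Kernel.integral_comp (η := P ^ n) (κ := Kernel.const Unit μ) (a := ())
    (f := f) (f.integrable _)
  rwa [Kernel.comp_apply, Kernel.const_apply] at h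

theorem integral_markovOp_of_invariant {μ : Measure Z} [IsFiniteMeasure μ] (hμ : P.Invariant μ)
    (n : ℕ) (f : Z →ᵇ ℝ) : ∫ z, (markovOp P hF ^ n) f z ∂μ = ∫ z, f z ∂μ := by
  induction n with
  | zero => simp
  | succ n ih =>
    have h := integral_bind_pow hF μ 1 ((markovOp P hF ^ n) f)
    rw [pow_one, pow_one, hμ.def, ih] at h
    rw [pow_succ', h]
    rfl

omit [CompactSpace Z] in
theorem continuous_integral_bcf (μ : Measure Z) [IsFiniteMeasure μ] :
    Continuous fun f : Z →ᵇ ℝ => ∫ z, f z ∂μ := by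
  have h : (fun f : Z →ᵇ ℝ => ∫ z, f z ∂μ) =
      fun f => ∫ z, BoundedContinuousFunction.toLp 1 μ ℝ f z ∂μ := by
    funext f
    exact integral_congr_ae (BoundedContinuousFunction.coeFn_toLp 1 μ ℝ f).symm
  rw [h]
  exact continuous_integral.comp (BoundedContinuousFunction.toLp 1 μ ℝ).continuous

/-- If the `k`-step average of `g` at `y` equals the maximum of `g`, then `g` attains its maximum
in every set charged by the `k`-step law from `y`. -/
theorem exists_mem_eq_of_markovOp_pow_eq {g : Z →ᵇ ℝ} {M : ℝ} (hg : ∀ z, g z ≤ M) {k : ℕ} {y : Z}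
    (hy : (markovOp P hF ^ k) g y = M) {O : Set Z} (hO : 0 < (P ^ k) y O) :
    ∃ x ∈ O, g x = M := by
  have := isMarkovKernel_pow P k
  by_contra! hne
  -- The nonnegative function `M - g` has integral zero, so it vanishes almost everywhere; it cannot
  -- be nonzero throughout the charged set `O`.
  have hint : ∫ z, (M - g z) ∂((P ^ k) y) = 0 := by
    rw [integral_sub (integrable_const _) (g.integrable _), ← markovOp_pow_apply hF, hy]
    simp
  have hae := (integral_eq_zero_iff_of_nonneg (fun z => sub_nonneg.2 (hg z))
    ((integrable_const M).sub (g.integrable _))).1 hint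
  refine hO.ne' (measure_mono_null (fun x hx => ?_) hae)
  simpa [sub_eq_zero] using (hne x hx).symm

/-- A continuous harmonic function is bounded above by its value at a reachable point. -/
theorem le_of_markovOp_eq_self {zstar : Z} (hreach : TopologicallyReachable P zstar)
    {h : Z →ᵇ ℝ} (hh : markovOp P hF h = h) (z : Z) : h z ≤ h zstar := by
  obtain ⟨y, -, hy⟩ := isCompact_univ.exists_isMaxOn ⟨z, Set.mem_univ z⟩ h.continuous.continuousOn
  have hmax : ∀ x, h x ≤ h y := fun x => hy (Set.mem_univ x)
  by_contra! hlt
  -- If the bound fails, this strict sublevel set is an open neighbourhood of `zstar`, hence charged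
  -- from the maximiser `y`.
  obtain ⟨k, -, hk⟩ := hreach y {x | h x < h y} (isOpen_lt h.continuous continuous_const)
    (hlt.trans_le (hmax z))
  have hpow : (markovOp P hF ^ k) h = h := by
    clear hk
    induction k with
    | zero => simp
    | succ k ih => rw [pow_succ']; exact (congrArg (markovOp P hF) ih).trans hh
  obtain ⟨x, hx, hxy⟩ := exists_mem_eq_of_markovOp_pow_eq hF hmax (by rw [hpow]) hk
  exact hx.ne hxy

theorem eq_const_of_markovOp_eq_self {zstar : Z} (hreach : TopologicallyReachable P zstar)
    {h : Z →ᵇ ℝ} (hh : markovOp P hF h = h) (z : Z) : h z = h zstar := by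
  refine le_antisymm (le_of_markovOp_eq_self hF hreach hh z) ?_
  have := le_of_markovOp_eq_self hF hreach (h := -h) (by rw [map_neg, hh]) z
  simpa using this

/-- The orbit of a Lipschitz function under the Markov operator of an L-chain is relatively
compact. -/
theorem isCompact_closure_orbit (hL : IsLChain P) {f : Z →ᵇ ℝ} {K : NNReal}
    (hf : LipschitzWith K f) :
    IsCompact (closure (Set.range fun n : ℕ => (markovOp P hF ^ n) f)) := by
  refine BoundedContinuousFunction.arzela_ascoli (Metric.closedBall 0 ‖f‖)
    (isCompact_closedBall _ _) _ ?_ ?_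
  · rintro _ x ⟨n, rfl⟩
    rw [mem_closedBall_zero_iff]
    exact (BoundedContinuousFunction.norm_coe_le_norm _ x).trans (norm_markovOp_pow_le hF n f)
  · have h := hL f ⟨K, hf⟩ (HasCompactSupport.of_compactSpace f)
    intro x U hU
    filter_upwards [h x U hU] with y hy
    rintro ⟨_, n, rfl⟩
    simpa only [markovOp_pow_apply] using hy n

end Operator

/-! ### Cesàro means of an operator orbit. -/

section Cesaro

/-- The average of the first `n + 1` points of the orbit of `x` under `T`. -/
noncomputable def cesaroMean {E : Type*} [NormedAddCommGroup E] [NormedSpace ℝ E]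
    (T : E →L[ℝ] E) (n : ℕ) (x : E) : E :=
  ((n : ℝ) + 1)⁻¹ • ∑ k ∈ Finset.range (n + 1), (T ^ k) x

theorem cesaroMean_mem_convexHull {E : Type*} [NormedAddCommGroup E] [NormedSpace ℝ E]
    (T : E →L[ℝ] E) (n : ℕ) (x : E) :
    cesaroMean T n x ∈ convexHull ℝ (Set.range fun k : ℕ => (T ^ k) x) := by
  rw [cesaroMean, Finset.smul_sum]
  refine (convex_convexHull ℝ _).sum_mem (fun _ _ => by positivity) ?_
    fun k _ => subset_convexHull ℝ _ ⟨k, rfl⟩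
  rw [Finset.sum_const, Finset.card_range, nsmul_eq_mul]
  push_cast
  exact mul_inv_cancel₀ (by positivity)

/-- The difference telescopes to `(T ^ (n + 1) x - x) / (n + 1)`, and the orbit is bounded. -/
theorem tendsto_map_cesaroMean_sub {E : Type*} [NormedAddCommGroup E] [NormedSpace ℝ E]
    (T : E →L[ℝ] E) (x : E) {C : ℝ} (hT : ∀ n : ℕ, ‖(T ^ n) x‖ ≤ C) :
    Tendsto (fun n => T (cesaroMean T n x) - cesaroMean T n x) atTop (𝓝 0) := by
  have key : ∀ n, T (cesaroMean T n x) - cesaroMean T n x =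
      ((n : ℝ) + 1)⁻¹ • ((T ^ (n + 1)) x - x) := by
    intro n
    rw [cesaroMean, map_smul, map_sum, ← smul_sub, ← Finset.sum_sub_distrib]
    congr 1
    have h := Finset.sum_range_sub (fun k => (T ^ k) x) (n + 1)
    simp only [pow_succ'] at h ⊢
    exact h
  have hlim : Tendsto (fun n : ℕ => ((n : ℝ) + 1)⁻¹ * (C + C)) atTop (𝓝 0) := by
    simpa [one_div] using (tendsto_one_div_add_atTop_nhds_zero_nat (𝕜 := ℝ)).mul_const (C + C)
  refine squeeze_zero_norm (fun n => ?_) hlim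
  rw [key, norm_smul, Real.norm_of_nonneg (by positivity)]
  gcongr
  exact (norm_sub_le _ _).trans (add_le_add (hT (n + 1)) (by simpa using hT 0))

end Cesaro

/-! ### Existence and uniqueness of the invariant law. -/

section Invariant

variable {Z : Type*} [MetricSpace Z] [CompactSpace Z] [MeasurableSpace Z] [BorelSpace Z]
  {P : Kernel Z Z} [IsMarkovKernel P] (hF : WeakFeller P)

theorem integral_cesaroMean (μ : Measure Z) [IsFiniteMeasure μ] (n : ℕ) (f : Z →ᵇ ℝ) :
    ∫ z, cesaroMean (markovOp P hF) n f z ∂μ =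
      ((n : ℝ) + 1)⁻¹ * ∑ k ∈ Finset.range (n + 1), ∫ z, (markovOp P hF ^ k) f z ∂μ := by
  rw [← integral_finsetSum _ (fun k _ => BoundedContinuousFunction.integrable _ _),
    ← integral_const_mul]
  simp [cesaroMean, BoundedContinuousFunction.sum_apply]

/-- The average of the first `n + 1` laws of the chain started at `z`. -/
noncomputable def cesaroLaw (P : Kernel Z Z) [IsMarkovKernel P] (z : Z) (n : ℕ) :
    ProbabilityMeasure Z :=
  ⟨((n + 1 : ℕ) : ENNReal)⁻¹ • ∑ k ∈ Finset.range (n + 1), (P ^ k) z, ⟨by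
    have := isMarkovKernel_pow P
    simp only [Measure.smul_apply, Measure.finsetSum_apply, measure_univ, Finset.sum_const,
      Finset.card_range, nsmul_eq_mul, mul_one, smul_eq_mul]
    exact ENNReal.inv_mul_cancel (by simp) (ENNReal.natCast_ne_top _)⟩⟩

theorem integral_cesaroLaw (z : Z) (n : ℕ) (f : Z →ᵇ ℝ) :
    ∫ y, f y ∂(cesaroLaw P z n : Measure Z) = cesaroMean (markovOp P hF) n f z := by
  have := isMarkovKernel_pow P
  change ∫ y, f y ∂(((n + 1 : ℕ) : ENNReal)⁻¹ • ∑ k ∈ Finset.range (n + 1), (P ^ k) z) = _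
  rw [integral_smul_measure, integral_finsetSum_measure fun k _ => f.integrable _]
  simp only [← markovOp_pow_apply hF, cesaroMean, BoundedContinuousFunction.smul_apply,
    BoundedContinuousFunction.sum_apply, ENNReal.toReal_inv, ENNReal.toReal_natCast, smul_eq_mul]
  push_cast
  rfl

/-- The Krylov–Bogolyubov theorem on a compact space. -/
theorem exists_invariant_of_weakFeller (hF : WeakFeller P) [Nonempty Z] :
    ∃ ν : ProbabilityMeasure Z, P.Invariant (ν : Measure Z) := by
  obtain ⟨z⟩ := ‹Nonempty Z›
  let U : Ultrafilter ℕ := hyperfilter ℕ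
  have hU : (U : Filter ℕ) ≤ atTop := Nat.hyperfilter_le_atTop
  obtain ⟨ν, -, hν⟩ := (isCompact_univ (X := ProbabilityMeasure Z)).ultrafilter_le_nhds
    (U.map (cesaroLaw P z)) (by simp)
  have hν' : Tendsto (cesaroLaw P z) U (𝓝 ν) := hν
  rw [ProbabilityMeasure.tendsto_iff_forall_integral_tendsto] at hν'
  refine ⟨ν, ext_of_forall_integral_eq_of_IsFiniteMeasure fun f => ?_⟩
  have hstep := integral_bind_pow hF (ν : Measure Z) 1 f
  rw [pow_one, pow_one] at hstep
  rw [hstep]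
  have h1 := (hν' (markovOp P hF f)).sub (hν' f)
  simp only [integral_cesaroLaw hF] at h1
  have hcomm : ∀ n, cesaroMean (markovOp P hF) n (markovOp P hF f) =
      markovOp P hF (cesaroMean (markovOp P hF) n f) := by
    intro n
    rw [cesaroMean, cesaroMean, map_smul, map_sum]
    congr 1
    refine Finset.sum_congr rfl fun k _ => ?_
    have h := DFunLike.congr_fun ((Commute.refl (markovOp P hF)).pow_left k).eq f
    exact h
  have h2 := (tendsto_map_cesaroMean_sub (markovOp P hF) f
    (fun n => norm_markovOp_pow_le hF n f)).mono_left hU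
  have h3 : Tendsto (fun n => (markovOp P hF (cesaroMean (markovOp P hF) n f) -
      cesaroMean (markovOp P hF) n f) z) U (𝓝 0) :=
    ((continuous_eval_const (F := Z →ᵇ ℝ) z).tendsto 0).comp h2
  simp only [hcomm] at h1
  exact sub_eq_zero.1 (tendsto_nhds_unique h1 h3)

/-- Two probability measures that integrate all Lipschitz functions alike are equal. -/
theorem eq_of_forall_lipschitz_integral_eq {μ ν : ProbabilityMeasure Z}
    (h : ∀ (f : Z →ᵇ ℝ) (K : NNReal), LipschitzWith K f →
      ∫ z, f z ∂(μ : Measure Z) = ∫ z, f z ∂(ν : Measure Z)) : μ = ν := by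
  have ht : Tendsto (fun _ : ℕ => μ) atTop (𝓝 ν) := by
    rw [tendsto_iff_forall_lipschitz_integral_tendsto]
    rintro f - ⟨K, hK⟩
    have := h (BoundedContinuousFunction.mkOfCompact ⟨f, hK.continuous⟩) K hK
    simp only [BoundedContinuousFunction.mkOfCompact_apply, ContinuousMap.coe_mk] at this
    rw [this]
    exact tendsto_const_nhds
  exact tendsto_nhds_unique tendsto_const_nhds ht

theorem invariant_unique (hF : WeakFeller P) (hL : IsLChain P) {zstar : Z} (hreach : TopologicallyReachable P zstar)
    {μ ν : ProbabilityMeasure Z} (hμ : P.Invariant (μ : Measure Z))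
    (hν : P.Invariant (ν : Measure Z)) : μ = ν := by
  refine eq_of_forall_lipschitz_integral_eq fun f K hf => ?_
  let U : Ultrafilter ℕ := hyperfilter ℕ
  have hU : (U : Filter ℕ) ≤ atTop := Nat.hyperfilter_le_atTop
  set T := markovOp P hF with hT
  -- Cesàro means leave the orbit but stay in its convex hull, which inherits total boundedness.
  have hcpt : IsCompact (closure (convexHull ℝ (Set.range fun n : ℕ => (T ^ n) f))) :=
    (TotallyBounded.convexHull ((isCompact_closure_orbit hF hL hf).totallyBounded.subset
      subset_closure)).closure.isCompact_of_isClosed isClosed_closure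
  obtain ⟨h, -, hh⟩ := hcpt.ultrafilter_le_nhds (U.map fun n => cesaroMean T n f) (by
    rw [le_principal_iff, Ultrafilter.mem_coe, Ultrafilter.mem_map]
    exact univ_mem' fun n => subset_closure (cesaroMean_mem_convexHull T n f))
  have hh' : Tendsto (fun n => cesaroMean T n f) U (𝓝 h) := hh
  have hfix : T h = h := by
    have h1 := ((T.continuous.tendsto h).comp hh').sub hh'
    have h2 := (tendsto_map_cesaroMean_sub T f
      (fun n => norm_markovOp_pow_le hF n f)).mono_left hU
    exact sub_eq_zero.1 (tendsto_nhds_unique h1 h2)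
  have hconst := eq_const_of_markovOp_eq_self hF hreach hfix
  have key : ∀ ρ : ProbabilityMeasure Z, P.Invariant (ρ : Measure Z) →
      ∫ z, f z ∂(ρ : Measure Z) = h zstar := by
    intro ρ hρ
    have h1 := ((continuous_integral_bcf (ρ : Measure Z)).tendsto h).comp hh'
    have h2 : ∀ n, ∫ z, cesaroMean T n f z ∂(ρ : Measure Z) = ∫ z, f z ∂(ρ : Measure Z) := by
      intro n
      rw [integral_cesaroMean, Finset.sum_congr rfl
        fun k _ => integral_markovOp_of_invariant hF hρ k f]
      simp only [Finset.sum_const, Finset.card_range, nsmul_eq_mul]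
      push_cast
      exact inv_mul_cancel_left₀ (by positivity) _
    simp only [Function.comp_def, h2, hconst, integral_const, probReal_univ, one_smul] at h1
    exact tendsto_nhds_unique tendsto_const_nhds h1
  rw [key μ hμ, key ν hν]

end Invariant

/-! ### Bi-infinite trajectories and their limits. -/

section Trajectory

/-- A bi-infinite orbit of the operator `T` that stays in the set `K`. -/
structure IsTrajectory {E : Type*} (T : E → E) (K : Set E) (h : ℤ → E) : Prop where
  mem : ∀ j, h j ∈ K
  step : ∀ j, T (h j) = h (j + 1)

theorem IsTrajectory.pow {E : Type*} [NormedAddCommGroup E] [NormedSpace ℝ E] {T : E →L[ℝ] E}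
    {K : Set E} {h : ℤ → E} (hh : IsTrajectory T K h) (k : ℕ) (j : ℤ) :
    (T ^ k) (h j) = h (j + k) := by
  induction k with
  | zero => simp
  | succ k ih =>
    rw [pow_succ']
    change T ((T ^ k) (h j)) = _
    rw [ih, hh.step]
    push_cast
    ring_nf

/-- Limits of asymptotic trajectories in a compact set are trajectories. -/
theorem exists_isTrajectory_tendsto {E : Type*} [TopologicalSpace E] [T2Space E] {T : E → E}
    (hT : Continuous T) {K : Set E} (hK : IsCompact K) {ι : Type*} (U : Ultrafilter ι)
    (a : ι → ℤ → E) (hmem : ∀ i j, a i j ∈ K) (hstep : ∀ j, ∀ᶠ i in U, T (a i j) = a i (j + 1)) :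
    ∃ h, IsTrajectory T K h ∧ ∀ j, Tendsto (fun i => a i j) U (𝓝 (h j)) := by
  have hex : ∀ j, ∃ x ∈ K, Tendsto (fun i => a i j) U (𝓝 x) := fun j =>
    hK.ultrafilter_le_nhds (U.map fun i => a i j) (by
      rw [le_principal_iff, Ultrafilter.mem_coe, Ultrafilter.mem_map]
      exact univ_mem' fun i => hmem i j)
  choose h hmem' hlim using hex
  refine ⟨h, ⟨hmem', fun j => ?_⟩, hlim⟩
  exact tendsto_nhds_unique (((hT.tendsto _).comp (hlim j)).congr' (hstep j)) (hlim (j + 1))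

end Trajectory

/-! ### Vanishing oscillation and weak convergence. -/

section Convergence

variable {Z : Type*} [MetricSpace Z] [CompactSpace Z] [MeasurableSpace Z] [BorelSpace Z]
  {P : Kernel Z Z} [IsMarkovKernel P] (hF : WeakFeller P)

/-- Since `T ^ k` sends `h (-k)` to `h 0`, a ball around `zstar` charged in `k` steps from a
maximiser of `h 0` contains a maximiser of `h (-k)`. Shrink the ball and take a limit of the
trajectories shifted by `-k`. -/
theorem exists_isTrajectory_apply_eq {zstar : Z} (hreach : TopologicallyReachable P zstar)
    {K : Set (Z →ᵇ ℝ)} (hK : IsCompact K) {M : ℝ} (hM : ∀ g ∈ K, IsGreatest (Set.range g) M)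
    {h : ℤ → Z →ᵇ ℝ} (hh : IsTrajectory (markovOp P hF) K h) :
    ∃ h', IsTrajectory (markovOp P hF) K h' ∧ h' 0 zstar = M := by
  obtain ⟨y, hy⟩ := (hM (h 0) (hh.mem 0)).1
  have hex : ∀ n : ℕ, ∃ (k : ℕ) (x : Z), dist x zstar < 1 / ((n : ℝ) + 1) ∧ h (-k) x = M := by
    intro n
    obtain ⟨k, -, hk⟩ := hreach y (Metric.ball zstar (1 / ((n : ℝ) + 1))) Metric.isOpen_ball
      (Metric.mem_ball_self (by positivity))
    obtain ⟨x, hx, hxM⟩ := exists_mem_eq_of_markovOp_pow_eq hF (g := h (-k))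
      (fun z => (hM _ (hh.mem _)).2 ⟨z, rfl⟩) (by rw [hh.pow, neg_add_cancel, hy]) hk
    exact ⟨k, x, hx, hxM⟩
  choose k x hx hxM using hex
  let U : Ultrafilter ℕ := hyperfilter ℕ
  have hU : (U : Filter ℕ) ≤ atTop := Nat.hyperfilter_le_atTop
  obtain ⟨h', hh', hlim⟩ := exists_isTrajectory_tendsto (markovOp P hF).continuous hK U
    (fun n j => h (-(k n) + j)) (fun _ _ => hh.mem _)
    (fun j => Eventually.of_forall fun n => by rw [hh.step, add_assoc])
  refine ⟨h', hh', ?_⟩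
  have hxlim : Tendsto x U (𝓝 zstar) := by
    rw [tendsto_iff_dist_tendsto_zero]
    exact squeeze_zero (fun _ => dist_nonneg) (fun n => (hx n).le)
      (tendsto_one_div_add_atTop_nhds_zero_nat.mono_left hU)
  have h1 := (continuous_eval.tendsto (h' 0, zstar)).comp ((hlim 0).prodMk_nhds hxlim)
  simp only [Function.comp_def, add_zero, hxM] at h1
  exact tendsto_nhds_unique h1 tendsto_const_nhds

/-- By aperiodicity `h (-m)` attains `M` near `zstar` for every large `m`, not just for some, so a
limit of the shifts by `-n` attains it at `zstar` at every time. -/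
theorem exists_isTrajectory_forall_apply_eq {zstar : Z} (haper : TopologicallyAperiodic P zstar)
    {K : Set (Z →ᵇ ℝ)} (hK : IsCompact K) {M : ℝ} (hM : ∀ g ∈ K, IsGreatest (Set.range g) M)
    {h : ℤ → Z →ᵇ ℝ} (hh : IsTrajectory (markovOp P hF) K h) (h0 : h 0 zstar = M) :
    ∃ h', IsTrajectory (markovOp P hF) K h' ∧ ∀ j, h' j zstar = M := by
  let U : Ultrafilter ℕ := hyperfilter ℕ
  have hU : (U : Filter ℕ) ≤ atTop := Nat.hyperfilter_le_atTop
  obtain ⟨h', hh', hlim⟩ := exists_isTrajectory_tendsto (markovOp P hF).continuous hK U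
    (fun (n : ℕ) j => h (-n + j)) (fun _ _ => hh.mem _)
    (fun j => Eventually.of_forall fun n => by rw [hh.step, add_assoc])
  refine ⟨h', hh', fun j => ?_⟩
  by_contra hne
  have hev : ∀ᶠ p : (Z →ᵇ ℝ) × Z in 𝓝 (h' j, zstar), p.1 p.2 ≠ M :=
    continuous_eval.continuousAt.eventually_ne hne
  rw [nhds_prod_eq, eventually_prod_iff] at hev
  obtain ⟨A, hA, B, hB, hAB⟩ := hev
  obtain ⟨O, hOB, hO, hzO⟩ := eventually_nhds_iff.1 hB
  have h1 : ∀ᶠ n : ℕ in U, 0 < (P ^ ((n : ℤ) - j).toNat) zstar O := by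
    refine Tendsto.eventually (f := fun n : ℕ => ((n : ℤ) - j).toNat) ?_ (haper O hO hzO)
    refine Tendsto.mono_left ?_ hU
    refine tendsto_atTop.2 fun b => ?_
    filter_upwards [eventually_ge_atTop (b + j.toNat)] with n hn
    omega
  obtain ⟨n, hn1, hn2, hn3⟩ := (h1.and (((hlim j).eventually hA).and
    (hU (eventually_ge_atTop j.toNat)))).exists
  have hcast : ((((n : ℤ) - j).toNat : ℕ) : ℤ) = n - j := Int.toNat_of_nonneg (by omega)
  obtain ⟨x, hx, hxM⟩ := exists_mem_eq_of_markovOp_pow_eq hF (g := h (-n + j))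
    (fun z => (hM _ (hh.mem _)).2 ⟨z, rfl⟩)
    (by rw [hh.pow, hcast, show -(n : ℤ) + j + (n - j) = 0 by ring, h0]) hn1
  exact hAB hn2 (hOB x hx) hxM

/-- If all functions of a compact set containing a trajectory have maximum `M` and minimum
`c - M'`, then reachability and aperiodicity force `M = c - M'`. -/
theorem add_eq_of_isTrajectory {zstar : Z} (hreach : TopologicallyReachable P zstar)
    (haper : TopologicallyAperiodic P zstar) {K : Set (Z →ᵇ ℝ)} (hK : IsCompact K) {c M M' : ℝ}
    (hM : ∀ g ∈ K, IsGreatest (Set.range g) M)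
    (hM' : ∀ g ∈ K, IsGreatest (Set.range (BoundedContinuousFunction.const Z c - g)) M')
    {h : ℤ → Z →ᵇ ℝ} (hh : IsTrajectory (markovOp P hF) K h) : M + M' = c := by
  obtain ⟨h₁, hh₁, h₁0⟩ := exists_isTrajectory_apply_eq hF hreach hK hM hh
  obtain ⟨h₂, hh₂, h₂M⟩ := exists_isTrajectory_forall_apply_eq hF haper hK hM hh₁ h₁0
  let C := BoundedContinuousFunction.const Z c
  -- The closed condition `g zstar = M` is built into `K'`, so it survives the next passage to a
  -- limit trajectory.
  let K' : Set (Z →ᵇ ℝ) := (fun g => C - g) '' (K ∩ {g | g zstar = M})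
  have hK' : IsCompact K' := (hK.inter_right (isClosed_eq
    (continuous_eval_const (F := Z →ᵇ ℝ) zstar) continuous_const)).image
      (continuous_const.sub continuous_id)
  have htraj : IsTrajectory (markovOp P hF) K' fun j => C - h₂ j := by
    refine ⟨fun j => ⟨h₂ j, ⟨hh₂.mem j, h₂M j⟩, rfl⟩, fun j => ?_⟩
    have hC := markovOp_pow_const hF 1 c
    rw [pow_one] at hC
    rw [map_sub, hh₂.step, hC]
  obtain ⟨h₃, hh₃, h₃0⟩ := exists_isTrajectory_apply_eq hF hreach hK'
    (by rintro _ ⟨g, hg, rfl⟩; exact hM' g hg.1) htraj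
  obtain ⟨g, hg, hgh⟩ := hh₃.mem 0
  have hgM : g zstar = M := hg.2
  rw [← hgh] at h₃0
  have h4 : c - g zstar = M' := h₃0
  linarith

omit [MeasurableSpace Z] [BorelSpace Z] in
theorem isGreatest_range_norm [Nonempty Z] {g : Z →ᵇ ℝ} (hg : ∀ z, 0 ≤ g z) :
    IsGreatest (Set.range g) ‖g‖ := by
  obtain ⟨y, -, hy⟩ := isCompact_univ.exists_isMaxOn Set.univ_nonempty g.continuous.continuousOn
  refine ⟨⟨y, le_antisymm (g.apply_le_norm y) ?_⟩, ?_⟩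
  · rw [BoundedContinuousFunction.norm_le (hg y)]
    intro z
    rw [Real.norm_of_nonneg (hg z)]
    exact hy (Set.mem_univ z)
  · rintro _ ⟨z, rfl⟩
    exact g.apply_le_norm z

theorem exists_tendsto_norm_markovOp_pow (f : Z →ᵇ ℝ) :
    ∃ M, Tendsto (fun n : ℕ => ‖(markovOp P hF ^ n) f‖) atTop (𝓝 M) := by
  refine ⟨_, tendsto_atTop_ciInf (antitone_nat_of_succ_le fun n => ?_)
    ⟨0, by rintro _ ⟨n, rfl⟩; exact norm_nonneg _⟩⟩
  rw [pow_succ']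
  exact norm_markovOp_le hF _

/-- For an aperiodic chain, the oscillation of `T^n f` tends to zero. -/
theorem exists_tendsto_norm_markovOp_pow_and (hL : IsLChain P) {zstar : Z}
    (hreach : TopologicallyReachable P zstar) (haper : TopologicallyAperiodic P zstar)
    {f : Z →ᵇ ℝ} {L : NNReal} (hf : LipschitzWith L f) {c : ℝ} (hf0 : ∀ z, 0 ≤ f z)
    (hfc : ∀ z, f z ≤ c) :
    ∃ M, Tendsto (fun n : ℕ => ‖(markovOp P hF ^ n) f‖) atTop (𝓝 M) ∧
      Tendsto (fun n : ℕ => c - ‖(markovOp P hF ^ n) (BoundedContinuousFunction.const Z c - f)‖)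
        atTop (𝓝 M) := by
  set T := markovOp P hF with hT
  let C := BoundedContinuousFunction.const Z c
  have : Nonempty Z := ⟨zstar⟩
  obtain ⟨M, hM⟩ := exists_tendsto_norm_markovOp_pow hF f
  obtain ⟨M', hM'⟩ := exists_tendsto_norm_markovOp_pow hF (C - f)
  have hCsub : ∀ n : ℕ, (T ^ n) (C - f) = C - (T ^ n) f := fun n => by
    rw [map_sub, markovOp_pow_const]
  let U : Ultrafilter ℕ := hyperfilter ℕ
  have hU : (U : Filter ℕ) ≤ atTop := Nat.hyperfilter_le_atTop
  -- `toNat` cuts negative times off at `0`, so the step relation at `j` holds only once `n ≥ -j`.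
  obtain ⟨h, hh, hlim⟩ := exists_isTrajectory_tendsto T.continuous
    (isCompact_closure_orbit hF hL hf) U (fun (n : ℕ) j => (T ^ ((n : ℤ) + j).toNat) f)
    (fun _ _ => subset_closure ⟨_, rfl⟩) (fun j => hU (by
      filter_upwards [eventually_ge_atTop (-j).toNat] with n hn
      rw [show ((n : ℤ) + (j + 1)).toNat = ((n : ℤ) + j).toNat + 1 by omega, pow_succ']
      rfl))
  have hshift : ∀ j : ℤ, Tendsto (fun n : ℕ => ((n : ℤ) + j).toNat) U atTop := fun j => by
    refine Tendsto.mono_left (tendsto_atTop.2 fun b => ?_) hU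
    filter_upwards [eventually_ge_atTop (b + (-j).toNat)] with n hn
    omega
  -- Nonnegativity turns the two norms into maxima, so members of `K` have maximum `M` and minimum
  -- `c - M'`.
  let K : Set (Z →ᵇ ℝ) := closure (Set.range fun n : ℕ => (T ^ n) f) ∩
    {g | (∀ z, 0 ≤ g z) ∧ (∀ z, 0 ≤ (C - g) z) ∧ ‖g‖ = M ∧ ‖C - g‖ = M'}
  have hK : IsCompact K := by
    refine (isCompact_closure_orbit hF hL hf).inter_right ?_
    have e : ∀ z, Continuous fun g : Z →ᵇ ℝ => g z :=
      fun z => continuous_eval_const (F := Z →ᵇ ℝ) z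
    have hsub : Continuous fun g : Z →ᵇ ℝ => C - g := continuous_const.sub continuous_id
    simp only [Set.ofPred_and, Set.ofPred_forall]
    refine IsClosed.inter ?_ (IsClosed.inter ?_ (IsClosed.inter ?_ ?_))
    · exact isClosed_iInter fun z => isClosed_le continuous_const (e z)
    · exact isClosed_iInter fun z => isClosed_le continuous_const ((e z).comp hsub)
    · exact isClosed_eq continuous_norm continuous_const
    · exact isClosed_eq hsub.norm continuous_const
  have htraj : IsTrajectory T K h := by
    refine ⟨fun j => ⟨hh.mem j, fun z => ?_, fun z => ?_, ?_, ?_⟩, hh.step⟩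
    · refine ge_of_tendsto (((continuous_eval_const (F := Z →ᵇ ℝ) z).tendsto _).comp
        (hlim j)) (Eventually.of_forall fun n => markovOp_pow_nonneg hF _ hf0 z)
    · refine ge_of_tendsto (((continuous_eval_const (F := Z →ᵇ ℝ) z).tendsto _).comp
        (tendsto_const_nhds.sub (hlim j))) (Eventually.of_forall fun n => ?_)
      simp only [Function.comp_def, ← hCsub]
      exact markovOp_pow_nonneg hF _ (fun z => sub_nonneg.2 (hfc z)) z
    · exact tendsto_nhds_unique (hlim j).norm (hM.comp (hshift j))
    · refine tendsto_nhds_unique (tendsto_const_nhds.sub (hlim j)).norm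
        ((hM'.comp (hshift j)).congr fun n => ?_)
      simp only [Function.comp_def, ← hT, hCsub]
  have hsum : M + M' = c := add_eq_of_isTrajectory hF hreach haper hK
    (fun g hg => hg.2.2.2.1 ▸ isGreatest_range_norm hg.2.1)
    (fun g hg => hg.2.2.2.2 ▸ isGreatest_range_norm hg.2.2.1) htraj
  refine ⟨M, hM, ?_⟩
  have := hM'.const_sub c
  rwa [show c - M' = M by linarith] at this

theorem tendsto_integral_markovOp_pow (hL : IsLChain P) {zstar : Z}
    (hreach : TopologicallyReachable P zstar) (haper : TopologicallyAperiodic P zstar)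
    {f : Z →ᵇ ℝ} {L : NNReal} (hf : LipschitzWith L f) :
    ∃ M, ∀ μ : ProbabilityMeasure Z,
      Tendsto (fun n : ℕ => ∫ z, (markovOp P hF ^ n) f z ∂(μ : Measure Z)) atTop (𝓝 M) := by
  -- Adding `‖f‖` moves the values of `f` into `[0, 2 * ‖f‖]`.
  let D := BoundedContinuousFunction.const Z ‖f‖
  let C := BoundedContinuousFunction.const Z (2 * ‖f‖)
  have hg : LipschitzWith L (f + D) := by
    simpa using! hf.add (LipschitzWith.const ‖f‖)
  have hpos : ∀ z, 0 ≤ (f + D) z := fun z => by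
    change 0 ≤ f z + ‖f‖
    linarith [f.neg_norm_le_apply z]
  have hle : ∀ z, (f + D) z ≤ 2 * ‖f‖ := fun z => by
    change f z + ‖f‖ ≤ _
    linarith [f.apply_le_norm z]
  obtain ⟨M, h1, h2⟩ := exists_tendsto_norm_markovOp_pow_and hF hL hreach haper hg hpos hle
  refine ⟨M - ‖f‖, fun μ => ?_⟩
  have hint : ∀ n : ℕ, ∫ z, (markovOp P hF ^ n) f z ∂(μ : Measure Z) =
      ∫ z, (markovOp P hF ^ n) (f + D) z ∂(μ : Measure Z) - ‖f‖ := by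
    intro n
    rw [map_add, markovOp_pow_const]
    have := integral_add (((markovOp P hF ^ n) f).integrable (μ : Measure Z)) (D.integrable _)
    have hD : ∫ z, D z ∂(μ : Measure Z) = ‖f‖ := by simp [D]
    rw [hD] at this
    exact eq_sub_of_add_eq this.symm
  simp only [hint]
  refine Tendsto.sub_const ?_ _
  -- The integral lies between a lower and an upper bound of `T ^ n (f + D)` that do not depend on
  -- `μ` and share the limit `M`.
  refine tendsto_of_tendsto_of_tendsto_of_le_of_le h2 h1 (fun n => ?_) (fun n => ?_)
  · have hlow : ∀ z, 2 * ‖f‖ - ‖(markovOp P hF ^ n) (C - (f + D))‖ ≤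
        (markovOp P hF ^ n) (f + D) z := fun z => by
      have := ((markovOp P hF ^ n) (C - (f + D))).apply_le_norm z
      have hz : (markovOp P hF ^ n) (C - (f + D)) z =
          2 * ‖f‖ - (markovOp P hF ^ n) (f + D) z := by
        rw [map_sub, markovOp_pow_const]; rfl
      linarith
    have := integral_mono (μ := (μ : Measure Z)) (integrable_const _)
      (((markovOp P hF ^ n) (f + D)).integrable _) hlow
    simpa using this
  · have := integral_mono (μ := (μ : Measure Z)) (((markovOp P hF ^ n) (f + D)).integrable _)
      (integrable_const _) ((markovOp P hF ^ n) (f + D)).apply_le_norm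
    simpa using this

theorem tendsto_nStepLaw (hF : WeakFeller P) (hL : IsLChain P) {zstar : Z}
    (hreach : TopologicallyReachable P zstar) (haper : TopologicallyAperiodic P zstar)
    {ν : ProbabilityMeasure Z} (hν : P.Invariant (ν : Measure Z)) (μ : ProbabilityMeasure Z) :
    Tendsto (fun n : ℕ => nStepLaw P μ n) atTop (𝓝 ν) := by
  rw [tendsto_iff_forall_lipschitz_integral_tendsto]
  rintro f - ⟨L, hf⟩
  let F := BoundedContinuousFunction.mkOfCompact ⟨f, hf.continuous⟩
  obtain ⟨M, hM⟩ := tendsto_integral_markovOp_pow hF hL hreach haper (f := F) hf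
  have h1 := hM ν
  simp only [integral_markovOp_of_invariant hF hν] at h1
  have h2 : ∫ z, f z ∂(ν : Measure Z) = M := tendsto_nhds_unique tendsto_const_nhds h1
  rw [h2]
  exact (hM μ).congr fun n => (integral_bind_pow hF (μ : Measure Z) n F).symm

end Convergence

end MarkovChain

theorem mainTheorem5 {Z : Type*} [MetricSpace Z] [CompactSpace Z] [MeasurableSpace Z]
    [BorelSpace Z] (P : Kernel Z Z) [IsMarkovKernel P]
    (hFeller : MarkovChain.WeakFeller P) (hL : MarkovChain.IsLChain P)
    (zstar : Z) (hreach : MarkovChain.TopologicallyReachable P zstar) :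
    ∃ ν : ProbabilityMeasure Z,
      (P.Invariant (ν : Measure Z) ∧
        ∀ ν' : ProbabilityMeasure Z, P.Invariant (ν' : Measure Z) → ν' = ν) ∧
      (MarkovChain.TopologicallyAperiodic P zstar →
        ∀ μ : ProbabilityMeasure Z,
          Tendsto (fun n : ℕ => MarkovChain.nStepLaw P μ n) atTop (𝓝 ν)) := by
  have : Nonempty Z := ⟨zstar⟩
  obtain ⟨ν, hν⟩ := MarkovChain.exists_invariant_of_weakFeller hFeller
  exact ⟨ν, ⟨hν, fun ν' hν' => MarkovChain.invariant_unique hFeller hL hreach hν' hν⟩,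
    fun haper μ => MarkovChain.tendsto_nStepLaw hFeller hL hreach haper hν μ⟩
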